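/- Fix a set $K$. A Kripke model $\mathfrak M=\langle W,R,\{P_k\}_{k\in K}\rangle$ consists of a nonempty set $W$, a binary relation $R$ on $W$ and a subset $P_k\subseteq W$ for each $k\in K$; Kripke models are identified with the structures for the first-order signature (with equality) consisting of a binary predicate symbol $\mathbf R$ and unary predicate symbols $\mathbf P_k$ ($k\in K$). Let $\Lambda\subseteq\{\smile,\frown\}$, where $\smile,\frown$ are unary connectives, and let $\mathcal L_\Lambda$ be the language generated by $$\varphi ::= p_k\mid\top\mid\bot\mid\varphi\wedge\varphi\mid\varphi\vee\varphi\mid \star\varphi\qquad(k\in K,\ \star\in\Lambda).$$ The standard translation $\mathrm{st}(x,\varphi)$ of $\varphi\in\mathcal L_\Lambda$ is the first-order formula defined recursively by $\mathrm{st}(x,p_k)=\mathbf P_kx$, $\mathrm{st}(x,\top)=(x=x)$, $\mathrm{st}(x,\bot)={\sim}(x=x)$, $\mathrm{st}(x,\varphi\wedge\psi)=\mathrm{st}(x,\varphi)\wedge\mathrm{st}(x,\psi)$, $\mathrm{st}(x,\varphi\vee\psi)=\mathrm{st}(x,\varphi)\vee\mathrm{st}(x,\psi)$, and, with $y$ a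 fresh variable, $\mathrm{st}(x,\smile\varphi)=\exists y\,(x\mathbf Ry\wedge{\sim}\mathrm{st}(y,\varphi))$ and $\mathrm{st}(x,\frown\varphi)=\forall y\,(x\mathbf Ry\to{\sim}\mathrm{st}(y,\varphi))$. A directed $\Lambda$-simulation between Kripke models $\mathfrak M_1=\langle W_1,R_1,\{P_{k,1}\}_{k\in K}\rangle$ and $\mathfrak M_2=\langle W_2,R_2,\{P_{k,2}\}_{k\in K}\rangle$ is a pair $(F,B)$ of relations $F\subseteq W_1\times W_2$, $B\subseteq W_2\times W_1$ such that - for all $k\in K$: if $(w_1,w_2)\in F$ and $w_1\in P_{k,1}$, then $w_2\in P_{k,2}$; and if $(w_2,w_1)\in B$ and $w_2\in P_{k,2}$, then $w_1\in P_{k,1}$; - if $\smile\,\in\Lambda$: whenever $(w_1,w_2)\in F$ and $w_1R_1v_1$, there is $t_2\in W_2$ with $w_2R_2t_2$ and $(t_2,v_1)\in B$; and whenever $(w_2,w_1)\in B$ and $w_2R_2v_2$, there is $t_1\in W_1$ with $w_1R_1t_1$ and $(t_1,v_2)\in F$; - if $\frown\,\in\Lambda$: whenever $(w_1,w_2)\in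 F$ and $w_2R_2v_2$, there is $t_1\in W_1$ with $w_1R_1t_1$ and $(v_2,t_1)\in B$; and whenever $(w_2,w_1)\in B$ and $w_1R_1v_1$, there is $t_2\in W_2$ with $w_2R_2t_2$ and $(v_1,t_2)\in F$. A first-order formula $\alpha(x)$ is preserved by directed $\Lambda$-simulations if for every directed $\Lambda$-simulation $(F,B)$ between Kripke models $\mathfrak M_1$ and $\mathfrak M_2$ and every $(w_1,w_2)\in F$, $\mathfrak M_1\Vdash\alpha(x)[w_1]$ implies $\mathfrak M_2\Vdash\alpha(x)[w_2]$. **Corollary 6.5 (directed relative characterization).** Let $\Lambda\subseteq\{\smile,\frown\}$ and let $\alpha(x)$ be a first-order formula over the above signature with no free variable other than $x$. Then $\alpha(x)$ is logically equivalent to $\mathrm{st}(x,\varphi)$ for some $\varphi\in\mathcal L_\Lambda$ if and only if $\alpha(x)$ is preserved by directed $\Lambda$-simulations. -/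

import Mathlib

universe u

namespace RestorativeModal

open FirstOrder

/-- The six unary connectives: the negations `⌣` (`smile`) and `⌢` (`frown`), and the restoration
connectives written as a white circle (`consistency` for `⌣`, `determinedness` for `⌢`) or as a
black circle (`inconsistency` for `⌣`, `undeterminedness` for `⌢`). -/
inductive Connective : Type
  | smile
  | frown
  | consistency
  | determinedness
  | inconsistency
  | undeterminedness

/-- A restorative similarity type: a set of the six connectives. -/
abbrev SimilarityType : Type := Set Connective

/-- The modal language `L_Λ` over propositional letters `p_k`, `k ∈ K`. -/
inductive ModalFormula (K : Type u) (Λ : SimilarityType) : Type u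
  | letter (k : K) : ModalFormula K Λ
  | top : ModalFormula K Λ
  | bot : ModalFormula K Λ
  | and (φ ψ : ModalFormula K Λ) : ModalFormula K Λ
  | or (φ ψ : ModalFormula K Λ) : ModalFormula K Λ
  | modal (c : Connective) (hc : c ∈ Λ) (φ : ModalFormula K Λ) : ModalFormula K Λ

/-- A Kripke model: a nonempty set of worlds with an accessibility relation `R` and
a truth set `P k` for each letter `p_k`. -/
structure KripkeModel (K : Type u) : Type (u + 1) where
  World : Type u
  nonempty : Nonempty World
  R : World → World → Prop
  P : K → Set World

/-- Relation symbols: a binary `𝐑` and a unary `𝐏_k` for each `k ∈ K`. -/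
inductive RelSymbol (K : Type u) : ℕ → Type u
  | acc : RelSymbol K 2
  | pred (k : K) : RelSymbol K 1

/-- The first-order signature of Kripke models, without function symbols. -/
def signature (K : Type u) : FirstOrder.Language.{0, u} where
  Functions := fun _ => Empty
  Relations := RelSymbol K

/-- A Kripke model seen as a first-order structure. -/
instance KripkeModel.instStructure {K : Type u} (M : KripkeModel K) :
    (signature K).Structure M.World where
  funMap := fun f => Empty.elim f
  RelMap := fun r =>
    match r with
    | .acc => fun v => M.R (v 0) (v 1)
    | .pred k => fun v => v 0 ∈ M.P k

/-- First-order formulas whose only free variable is `x` (the unique element of `Unit`);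
bound variables are de Bruijn levels. -/
abbrev FOFormula (K : Type u) : Type u := (signature K).Formula Unit

/-- `𝐏_k x` -/
def predAt {K : Type u} {n : ℕ} (k : K) (x : Unit ⊕ Fin n) :
    (signature K).BoundedFormula Unit n :=
  Language.Relations.boundedFormula₁ (L := signature K) (RelSymbol.pred k) (Language.Term.var x)

/-- `x = x` -/
def selfEq {K : Type u} {n : ℕ} (x : Unit ⊕ Fin n) : (signature K).BoundedFormula Unit n :=
  Language.Term.bdEqual (Language.Term.var x) (Language.Term.var x)

/-- `x 𝐑 y`, where `y` is a fresh variable to be bound by the next quantifier. -/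
def accFresh {K : Type u} {n : ℕ} (x : Unit ⊕ Fin n) :
    (signature K).BoundedFormula Unit (n + 1) :=
  Language.Relations.boundedFormula₂ (L := signature K) RelSymbol.acc
    (Language.Term.var (Sum.map id Fin.castSucc x)) (Language.Term.var (Sum.inr (Fin.last n)))

/-- The standard translation `st(x, φ)`, where `x` is the free variable or one of the `n` variables
bound so far. -/
def st {K : Type u} {Λ : SimilarityType} :
    {n : ℕ} → Unit ⊕ Fin n → ModalFormula K Λ → (signature K).BoundedFormula Unit n
  | _, x, .letter k => predAt k x
  | _, x, .top => selfEq x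
  | _, x, .bot => (selfEq x).not
  | _, x, .and φ ψ => st x φ ⊓ st x ψ
  | _, x, .or φ ψ => st x φ ⊔ st x ψ
  | n, x, .modal .smile _ φ => (accFresh x ⊓ (st (Sum.inr (Fin.last n)) φ).not).ex
  | n, x, .modal .frown _ φ => ((accFresh x).imp (st (Sum.inr (Fin.last n)) φ).not).all
  | n, x, .modal .consistency _ φ =>
      (st x φ).not ⊔ ((accFresh x).imp (st (Sum.inr (Fin.last n)) φ)).all
  | n, x, .modal .determinedness _ φ =>
      st x φ ⊔ ((accFresh x).imp (st (Sum.inr (Fin.last n)) φ).not).all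
  | n, x, .modal .inconsistency _ φ =>
      st x φ ⊓ (accFresh x ⊓ (st (Sum.inr (Fin.last n)) φ).not).ex
  | n, x, .modal .undeterminedness _ φ =>
      (st x φ).not ⊓ (accFresh x ⊓ st (Sum.inr (Fin.last n)) φ).ex

/-- The standard translation of a modal formula, as a first-order formula in the free variable
`x`. -/
def standardTranslation {K : Type u} {Λ : SimilarityType} (φ : ModalFormula K Λ) : FOFormula K :=
  st (Sum.inl ()) φ

/-- `M ⊩ α(x)[w]`: the formula `α(x)` holds in `M` when `w` is assigned to `x`. -/
def KripkeModel.SatisfiesAt {K : Type u} (M : KripkeModel K) (α : FOFormula K) (w : M.World) :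
    Prop :=
  Language.Formula.Realize (M := M.World) α (fun _ => w)

/-- Logical equivalence of `α(x)` and `β(x)`, that is, equivalence modulo the empty theory. -/
def Equivalent {K : Type u} (α β : FOFormula K) : Prop :=
  Language.Theory.Iff (∅ : (signature K).Theory) α β

/-- `(F, B)` is a directed `Λ`-simulation between `M₁` and `M₂`; meant for `Λ ⊆ {⌣, ⌢}`. -/
structure IsDirectedSimulation {K : Type u} (Λ : SimilarityType) (M₁ M₂ : KripkeModel K)
    (F : M₁.World → M₂.World → Prop) (B : M₂.World → M₁.World → Prop) : Prop where
  forth_letter : ∀ k w₁ w₂, F w₁ w₂ → w₁ ∈ M₁.P k → w₂ ∈ M₂.P k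
  back_letter : ∀ k w₂ w₁, B w₂ w₁ → w₂ ∈ M₂.P k → w₁ ∈ M₁.P k
  forth_smile : Connective.smile ∈ Λ → ∀ w₁ w₂ v₁, F w₁ w₂ → M₁.R w₁ v₁ →
    ∃ t₂, M₂.R w₂ t₂ ∧ B t₂ v₁
  back_smile : Connective.smile ∈ Λ → ∀ w₂ w₁ v₂, B w₂ w₁ → M₂.R w₂ v₂ →
    ∃ t₁, M₁.R w₁ t₁ ∧ F t₁ v₂
  forth_frown : Connective.frown ∈ Λ → ∀ w₁ w₂ v₂, F w₁ w₂ → M₂.R w₂ v₂ →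
    ∃ t₁, M₁.R w₁ t₁ ∧ B v₂ t₁
  back_frown : Connective.frown ∈ Λ → ∀ w₂ w₁ v₁, B w₂ w₁ → M₁.R w₁ v₁ →
    ∃ t₂, M₂.R w₂ t₂ ∧ F v₁ t₂

/-- `α(x)` is preserved by directed `Λ`-simulations. -/
def PreservedByDirectedSimulations {K : Type u} (Λ : SimilarityType) (α : FOFormula K) : Prop :=
  ∀ (M₁ M₂ : KripkeModel K) (F : M₁.World → M₂.World → Prop) (B : M₂.World → M₁.World → Prop),
    IsDirectedSimulation Λ M₁ M₂ F B →
      ∀ (w₁ : M₁.World) (w₂ : M₂.World), F w₁ w₂ → M₁.SatisfiesAt α w₁ → M₂.SatisfiesAt α w₂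

end RestorativeModal

/-!
Directed simulations preserve the formulas of `L_Λ` by induction. Conversely, let `α` be preserved
and approximate directed simulations by simulations lasting `n` rounds and respecting finitely many
letters. Some approximation already preserves `α`: otherwise choose a counterexample for every
approximation and form the ultraproducts of both sides. Between them, "the coordinates are related
for `k i` rounds, where `k` tends to infinity along the ultrafilter" is a directed simulation,
because passing to a successor costs only one round; it relates worlds that `α` separates, by Łoś's
theorem. Finally, a bounded simulation exists as soon as the truth of finitely many modal formulas
is transferred, so `α` is equivalent to a finite disjunction of finite conjunctions of these.
-/

namespace RestorativeModal

open FirstOrder Filter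

variable {K : Type u} {Λ : SimilarityType}

instance KripkeModel.instNonempty (M : KripkeModel K) : Nonempty M.World := M.nonempty

section Semantics

/-- Truth of a modal formula at a world of a Kripke model, without the detour through the standard
translation. -/
def KripkeModel.Sat (M : KripkeModel K) : M.World → ModalFormula K Λ → Prop
  | w, .letter k => w ∈ M.P k
  | _, .top => True
  | _, .bot => False
  | w, .and φ ψ => M.Sat w φ ∧ M.Sat w ψ
  | w, .or φ ψ => M.Sat w φ ∨ M.Sat w ψ
  | w, .modal .smile _ φ => ∃ v, M.R w v ∧ ¬M.Sat v φ
  | w, .modal .frown _ φ => ∀ v, M.R w v → ¬M.Sat v φ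
  | w, .modal .consistency _ φ => ¬M.Sat w φ ∨ ∀ v, M.R w v → M.Sat v φ
  | w, .modal .determinedness _ φ => M.Sat w φ ∨ ∀ v, M.R w v → ¬M.Sat v φ
  | w, .modal .inconsistency _ φ => M.Sat w φ ∧ ∃ v, M.R w v ∧ ¬M.Sat v φ
  | w, .modal .undeterminedness _ φ => ¬M.Sat w φ ∧ ∃ v, M.R w v ∧ M.Sat v φ

theorem realize_accFresh (M : KripkeModel K) {n : ℕ} (x : Unit ⊕ Fin n) (e : Unit → M.World)
    (xs : Fin n → M.World) (a : M.World) :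
    (accFresh (K := K) x).Realize e (Fin.snoc xs a : Fin (n + 1) → M.World) ↔
      M.R (Sum.elim e xs x) a := by
  refine (Language.BoundedFormula.realize_rel₂ (L := signature K)).trans ?_
  change M.R _ _ ↔ _
  cases x <;> simp

theorem realize_st (M : KripkeModel K) (φ : ModalFormula K Λ) {n : ℕ} (x : Unit ⊕ Fin n)
    (e : Unit → M.World) (xs : Fin n → M.World) :
    (st x φ).Realize e xs ↔ M.Sat (Sum.elim e xs x) φ := by
  induction φ generalizing n with
  | letter k => exact Language.BoundedFormula.realize_rel₁ (L := signature K)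
  | top => simp [st, selfEq, KripkeModel.Sat]
  | bot => simp [st, selfEq, KripkeModel.Sat]
  | and φ ψ ihφ ihψ => simp [st, KripkeModel.Sat, ihφ, ihψ]
  | or φ ψ ihφ ihψ => simp [st, KripkeModel.Sat, ihφ, ihψ]
  | modal c hc φ ih => cases c <;> simp [st, KripkeModel.Sat, ih, realize_accFresh]

theorem satisfiesAt_standardTranslation (M : KripkeModel K) (φ : ModalFormula K Λ) (w : M.World) :
    M.SatisfiesAt (standardTranslation φ) w ↔ M.Sat w φ :=
  realize_st M φ _ _ _

/-- The Kripke model given by a nonempty first-order structure for the signature. -/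
def KripkeModel.ofStructure (W : Type u) [Nonempty W] [(signature K).Structure W] :
    KripkeModel K where
  World := W
  nonempty := inferInstance
  R a b := Language.Structure.RelMap (L := signature K) RelSymbol.acc ![a, b]
  P k := {a | Language.Structure.RelMap (L := signature K) (RelSymbol.pred k) ![a]}

theorem KripkeModel.instStructure_ofStructure (W : Type u) [Nonempty W]
    [S : (signature K).Structure W] : (ofStructure (K := K) W).instStructure = S := by
  refine Language.Structure.ext (funext₂ fun _ f => f.elim) (funext₃ fun n r v => ?_)
  cases r with
  | acc => exact congrArg (S.RelMap RelSymbol.acc) (List.ofFn_injective rfl)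
  | pred k => exact congrArg (S.RelMap (RelSymbol.pred k)) (List.ofFn_injective rfl)

theorem KripkeModel.satisfiesAt_ofStructure (W : Type u) [Nonempty W] [(signature K).Structure W]
    (α : FOFormula K) (w : W) :
    (ofStructure (K := K) W).SatisfiesAt α w ↔ α.Realize (fun _ => w) := by
  unfold SatisfiesAt
  rw [instStructure_ofStructure]
  rfl

theorem equivalent_iff {α β : FOFormula K} :
    Equivalent α β ↔ ∀ (M : KripkeModel K) (w : M.World),
      M.SatisfiesAt α w ↔ M.SatisfiesAt β w := by
  constructor
  · exact fun h M w => h.realize_iff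
  · intro h W e xs
    rw [Language.BoundedFormula.realize_iff, Subsingleton.elim xs default]
    have hW := h (.ofStructure W) (e ())
    rwa [KripkeModel.satisfiesAt_ofStructure, KripkeModel.satisfiesAt_ofStructure] at hW

theorem equivalent_standardTranslation_iff {α : FOFormula K} {φ : ModalFormula K Λ} :
    Equivalent α (standardTranslation φ) ↔
      ∀ (M : KripkeModel K) (w : M.World), M.SatisfiesAt α w ↔ M.Sat w φ := by
  simp only [equivalent_iff, satisfiesAt_standardTranslation]

end Semantics

section DirectedSimulation

variable {M₁ M₂ : KripkeModel K} {F : M₁.World → M₂.World → Prop} {B : M₂.World → M₁.World → Prop}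

theorem IsDirectedSimulation.symm (h : IsDirectedSimulation Λ M₁ M₂ F B) :
    IsDirectedSimulation Λ M₂ M₁ B F where
  forth_letter := h.back_letter
  back_letter := h.forth_letter
  forth_smile := h.back_smile
  back_smile := h.forth_smile
  forth_frown := h.back_frown
  back_frown := h.forth_frown

theorem IsDirectedSimulation.sat_of_sat (hΛ : Λ ⊆ {Connective.smile, Connective.frown})
    (h : IsDirectedSimulation Λ M₁ M₂ F B) {φ : ModalFormula K Λ} {w₁ : M₁.World} {w₂ : M₂.World}
    (hF : F w₁ w₂) (hφ : M₁.Sat w₁ φ) : M₂.Sat w₂ φ := by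
  induction φ generalizing M₁ M₂ with
  | letter k => exact h.forth_letter k _ _ hF hφ
  | top => trivial
  | bot => exact hφ
  | and φ ψ ihφ ihψ => exact hφ.imp (ihφ h hF) (ihψ h hF)
  | or φ ψ ihφ ihψ => exact hφ.imp (ihφ h hF) (ihψ h hF)
  | modal c hc φ ih =>
    rcases hΛ hc with rfl | rfl
    · obtain ⟨v₁, hv₁, hφ⟩ := hφ
      obtain ⟨v₂, hv₂, hB⟩ := h.forth_smile hc _ _ _ hF hv₁
      exact ⟨v₂, hv₂, fun hv₂φ => hφ (ih h.symm hB hv₂φ)⟩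
    · intro v₂ hv₂ hv₂φ
      obtain ⟨v₁, hv₁, hB⟩ := h.forth_frown hc _ _ _ hF hv₂
      exact hφ v₁ hv₁ (ih h.symm hB hv₂φ)

end DirectedSimulation

/-- `SimulatesUpTo Λ s n M₁ M₂ w₁ w₂`: the approximation to "`F w₁ w₂` for some directed
`Λ`-simulation `(F, B)`" in which only the letters in `s` are compared and only `n` rounds are
played. The models trade places after each round, which accounts for the relation `B`. The letters
are compared at the beginning of a round, so that zero rounds impose no condition. -/
def SimulatesUpTo (Λ : SimilarityType) (s : Finset K) :
    ℕ → (M₁ M₂ : KripkeModel K) → M₁.World → M₂.World → Prop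
  | 0, _, _, _, _ => True
  | n + 1, M₁, M₂, w₁, w₂ =>
    (∀ k ∈ s, w₁ ∈ M₁.P k → w₂ ∈ M₂.P k) ∧
    (Connective.smile ∈ Λ → ∀ v₁, M₁.R w₁ v₁ →
      ∃ v₂, M₂.R w₂ v₂ ∧ SimulatesUpTo Λ s n M₂ M₁ v₂ v₁) ∧
    (Connective.frown ∈ Λ → ∀ v₂, M₂.R w₂ v₂ →
      ∃ v₁, M₁.R w₁ v₁ ∧ SimulatesUpTo Λ s n M₂ M₁ v₂ v₁)

section Definability

/-- The conjunction of a list of modal formulas. -/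
def conjunction (l : List (ModalFormula K Λ)) : ModalFormula K Λ := l.foldr .and .top

/-- The disjunction of a list of modal formulas. -/
def disjunction (l : List (ModalFormula K Λ)) : ModalFormula K Λ := l.foldr .or .bot

theorem sat_conjunction {M : KripkeModel K} {w : M.World} {l : List (ModalFormula K Λ)} :
    M.Sat w (conjunction l) ↔ ∀ φ ∈ l, M.Sat w φ := by
  induction l with
  | nil => simp [conjunction, KripkeModel.Sat]
  | cons φ l ih => rw [List.forall_mem_cons, ← ih]; rfl

theorem sat_disjunction {M : KripkeModel K} {w : M.World} {l : List (ModalFormula K Λ)} :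
    M.Sat w (disjunction l) ↔ ∃ φ ∈ l, M.Sat w φ := by
  induction l with
  | nil => simp [disjunction, KripkeModel.Sat]
  | cons φ l ih => rw [List.exists_mem_cons_iff, ← ih]; rfl

/-- The truth of the modal formulas in `l` transfers from the world `w₁` to the world `w₂`. -/
def TransfersTruth (l : List (ModalFormula K Λ)) (M₁ M₂ : KripkeModel K) (w₁ : M₁.World)
    (w₂ : M₂.World) : Prop :=
  ∀ φ ∈ l, M₁.Sat w₁ φ → M₂.Sat w₂ φ

variable {l l' : List (ModalFormula K Λ)} {M₁ M₂ : KripkeModel K} {w₁ : M₁.World} {w₂ : M₂.World}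

theorem TransfersTruth.exists_of_smile {hc : Connective.smile ∈ Λ}
    (hl : ∀ T, T.Sublist l → .modal .smile hc (disjunction T) ∈ l')
    (h : TransfersTruth l' M₁ M₂ w₁ w₂) {v₁ : M₁.World} (hv₁ : M₁.R w₁ v₁) :
    ∃ v₂, M₂.R w₂ v₂ ∧ TransfersTruth l M₂ M₁ v₂ v₁ := by
  classical
  let T := l.filter fun φ => ¬M₁.Sat v₁ φ
  have hv₁T : ¬M₁.Sat v₁ (disjunction T) := by simp [T, sat_disjunction]
  obtain ⟨v₂, hv₂, hv₂T⟩ := h _ (hl T List.filter_sublist) ⟨v₁, hv₁, hv₁T⟩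
  refine ⟨v₂, hv₂, fun φ hφ hv₂φ => ?_⟩
  by_contra hv₁φ
  exact hv₂T (sat_disjunction.2 ⟨φ, by simp [T, hφ, hv₁φ], hv₂φ⟩)

theorem TransfersTruth.exists_of_frown {hc : Connective.frown ∈ Λ}
    (hl : ∀ T, T.Sublist l → .modal .frown hc (conjunction T) ∈ l')
    (h : TransfersTruth l' M₁ M₂ w₁ w₂) {v₂ : M₂.World} (hv₂ : M₂.R w₂ v₂) :
    ∃ v₁, M₁.R w₁ v₁ ∧ TransfersTruth l M₂ M₁ v₂ v₁ := by
  classical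
  let T := l.filter fun φ => M₂.Sat v₂ φ
  have hv₂T : M₂.Sat v₂ (conjunction T) := by simp [T, sat_conjunction]
  obtain ⟨v₁, hv₁, hv₁T⟩ : ∃ v₁, M₁.R w₁ v₁ ∧ M₁.Sat v₁ (conjunction T) := by
    by_contra! hT
    exact h _ (hl T List.filter_sublist) hT v₂ hv₂ hv₂T
  exact ⟨v₁, hv₁, fun φ hφ hv₂φ => sat_conjunction.1 hv₁T φ (by simp [T, hφ, hv₂φ])⟩

theorem exists_list_modal_mem (c : Connective) (l : List (ModalFormula K Λ)) :
    ∃ l' : List (ModalFormula K Λ), ∀ hc : c ∈ Λ, ∀ φ ∈ l, .modal c hc φ ∈ l' := by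
  by_cases hc : c ∈ Λ
  · exact ⟨l.map (.modal c hc), fun _ _ => List.mem_map_of_mem⟩
  · exact ⟨[], fun hc' => absurd hc' hc⟩

theorem exists_list_simulatesUpTo (Λ : SimilarityType) (s : Finset K) (n : ℕ) :
    ∃ l : List (ModalFormula K Λ), ∀ (M₁ M₂ : KripkeModel K) (w₁ : M₁.World) (w₂ : M₂.World),
      TransfersTruth l M₁ M₂ w₁ w₂ → SimulatesUpTo Λ s n M₁ M₂ w₁ w₂ := by
  induction n with
  | zero => exact ⟨[], fun _ _ _ _ _ => trivial⟩
  | succ n ih =>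
    obtain ⟨l, hl⟩ := ih
    obtain ⟨l₁, hl₁⟩ := exists_list_modal_mem .smile (l.sublists.map disjunction)
    obtain ⟨l₂, hl₂⟩ := exists_list_modal_mem .frown (l.sublists.map conjunction)
    refine ⟨s.toList.map .letter ++ l₁ ++ l₂, fun M₁ M₂ w₁ w₂ h => ⟨?_, ?_, ?_⟩⟩
    · exact fun k hk => h (.letter k) (by simp [hk])
    · intro hc v₁ hv₁
      obtain ⟨v₂, hv₂, hv⟩ := h.exists_of_smile (hc := hc) (l := l)
        (fun T hT => List.mem_append_left _ <| List.mem_append_right _ <|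
          hl₁ hc _ (List.mem_map_of_mem (List.mem_sublists.2 hT))) hv₁
      exact ⟨v₂, hv₂, hl _ _ _ _ hv⟩
    · intro hc v₂ hv₂
      obtain ⟨v₁, hv₁, hv⟩ := h.exists_of_frown (hc := hc) (l := l)
        (fun T hT => List.mem_append_right _ <|
          hl₂ hc _ (List.mem_map_of_mem (List.mem_sublists.2 hT))) hv₂
      exact ⟨v₁, hv₁, hl _ _ _ _ hv⟩

theorem exists_sat_iff_of_transfersTruth (l : List (ModalFormula K Λ))
    {A : ∀ M : KripkeModel K, M.World → Prop}
    (hA : ∀ (M₁ M₂ : KripkeModel K) (w₁ : M₁.World) (w₂ : M₂.World),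
      TransfersTruth l M₁ M₂ w₁ w₂ → A M₁ w₁ → A M₂ w₂) :
    ∃ φ : ModalFormula K Λ, ∀ (M : KripkeModel K) (w : M.World), A M w ↔ M.Sat w φ := by
  classical
  let Entails (T : List (ModalFormula K Λ)) : Prop :=
    ∀ (M : KripkeModel K) (w : M.World), M.Sat w (conjunction T) → A M w
  refine ⟨disjunction ((l.sublists.filter Entails).map conjunction), fun M w => ?_⟩
  simp only [sat_disjunction, List.mem_map, List.mem_filter, List.mem_sublists,
    decide_eq_true_eq, exists_exists_and_eq_and]
  constructor
  · intro hw
    refine ⟨l.filter fun φ => M.Sat w φ, ⟨List.filter_sublist, fun M' w' hw' => ?_⟩,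
      by simp [sat_conjunction]⟩
    exact hA M M' w w' (fun φ hφ hwφ => sat_conjunction.1 hw' φ (by simp [hφ, hwφ])) hw
  · rintro ⟨T, ⟨-, hT⟩, hw⟩
    exact hT M w hw

end Definability

section Ultraproduct

variable {ι : Type u} (𝒰 : Ultrafilter ι) (M N : ι → KripkeModel K)

/-- The ultraproduct of a family of Kripke models. -/
def ultraproduct : KripkeModel K :=
  .ofStructure ((𝒰 : Filter ι).Product fun i => (M i).World)

variable {M N}

/-- The world of the ultraproduct represented by a family of worlds. -/
def ultraproduct.mk (w : ∀ i, (M i).World) : (ultraproduct 𝒰 M).World :=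
  Quotient.mk _ w

variable {𝒰}

theorem ultraproduct.exists_mk_eq (x : (ultraproduct 𝒰 M).World) : ∃ w, mk 𝒰 w = x :=
  Quotient.exists_rep x

theorem ultraproduct.satisfiesAt_mk {α : FOFormula K} {w : ∀ i, (M i).World} :
    (ultraproduct 𝒰 M).SatisfiesAt α (mk 𝒰 w) ↔ ∀ᶠ i in 𝒰, (M i).SatisfiesAt α (w i) :=
  (KripkeModel.satisfiesAt_ofStructure _ α _).trans
    (Language.Ultraproduct.realize_formula_cast α fun _ => w)

theorem ultraproduct.mk_mem_P {k : K} {w : ∀ i, (M i).World} :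
    mk 𝒰 w ∈ (ultraproduct 𝒰 M).P k ↔ ∀ᶠ i in 𝒰, w i ∈ (M i).P k := by
  have h := satisfiesAt_mk (𝒰 := 𝒰) (α := standardTranslation (Λ := ∅) (.letter k)) (w := w)
  simpa only [satisfiesAt_standardTranslation, KripkeModel.Sat] using h

theorem ultraproduct.R_mk_mk {w v : ∀ i, (M i).World} :
    (ultraproduct 𝒰 M).R (mk 𝒰 w) (mk 𝒰 v) ↔ ∀ᶠ i in 𝒰, (M i).R (w i) (v i) := by
  have hmk : ![mk 𝒰 w, mk 𝒰 v] = fun j => mk 𝒰 (![w, v] j) := List.ofFn_injective rfl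
  refine (iff_of_eq (congrArg (Language.Structure.RelMap (L := signature K)
    (M := (𝒰 : Filter ι).Product fun i => (M i).World) RelSymbol.acc) hmk)).trans ?_
  exact Language.relMap_quotient_mk' (L := signature K)
    (s := (𝒰 : Filter ι).productSetoid fun i => (M i).World) RelSymbol.acc ![w, v]

/-- The worlds of two ultraproducts that have representatives related by simulations whose numbers
of rounds tend to infinity along the ultrafilter. -/
def SimulatesAlong (Λ : SimilarityType) (s : ι → Finset K) (x : (ultraproduct 𝒰 M).World)
    (y : (ultraproduct 𝒰 N).World) : Prop :=
  ∃ (w : ∀ i, (M i).World) (v : ∀ i, (N i).World) (n : ι → ℕ),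
    ultraproduct.mk 𝒰 w = x ∧ ultraproduct.mk 𝒰 v = y ∧ Tendsto n 𝒰 atTop ∧
      ∀ᶠ i in 𝒰, SimulatesUpTo Λ (s i) (n i) (M i) (N i) (w i) (v i)

namespace SimulatesAlong

variable {s : ι → Finset K} {x : (ultraproduct 𝒰 M).World} {y : (ultraproduct 𝒰 N).World}

theorem exists_succ (h : SimulatesAlong Λ s x y) :
    ∃ (w : ∀ i, (M i).World) (v : ∀ i, (N i).World) (n : ι → ℕ),
      ultraproduct.mk 𝒰 w = x ∧ ultraproduct.mk 𝒰 v = y ∧ Tendsto n 𝒰 atTop ∧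
        ∀ᶠ i in 𝒰, SimulatesUpTo Λ (s i) (n i + 1) (M i) (N i) (w i) (v i) := by
  obtain ⟨w, v, n, hw, hv, hn, hsim⟩ := h
  refine ⟨w, v, fun i => n i - 1, hw, hv, (tendsto_sub_atTop_nat 1).comp hn, ?_⟩
  filter_upwards [hsim, hn.eventually_ge_atTop 1] with i hi hni
  rwa [Nat.sub_add_cancel hni]

theorem mem_P (hs : ∀ k, ∀ᶠ i in 𝒰, k ∈ s i) (h : SimulatesAlong Λ s x y) {k : K}
    (hx : x ∈ (ultraproduct 𝒰 M).P k) : y ∈ (ultraproduct 𝒰 N).P k := by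
  obtain ⟨w, v, n, rfl, rfl, -, hsim⟩ := h.exists_succ
  rw [ultraproduct.mk_mem_P] at hx ⊢
  filter_upwards [hsim, hs k, hx] with i hi hk hwk
  obtain ⟨hletter, -, -⟩ := hi
  exact hletter k hk hwk

theorem exists_of_smile (hc : Connective.smile ∈ Λ) (h : SimulatesAlong Λ s x y)
    {x' : (ultraproduct 𝒰 M).World} (hx' : (ultraproduct 𝒰 M).R x x') :
    ∃ y', (ultraproduct 𝒰 N).R y y' ∧ SimulatesAlong Λ s y' x' := by
  obtain ⟨w, v, n, rfl, rfl, hn, hsim⟩ := h.exists_succ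
  obtain ⟨w', rfl⟩ := ultraproduct.exists_mk_eq x'
  have hstep : ∀ᶠ i in 𝒰, ∃ v', (N i).R (v i) v' ∧
      SimulatesUpTo Λ (s i) (n i) (N i) (M i) v' (w' i) := by
    filter_upwards [hsim, ultraproduct.R_mk_mk.1 hx'] with i hi hw'
    obtain ⟨-, hsmile, -⟩ := hi
    exact hsmile hc _ hw'
  obtain ⟨v', hv'⟩ := skolem.1 hstep
  exact ⟨ultraproduct.mk 𝒰 v', ultraproduct.R_mk_mk.2 (hv'.mono fun _ hi => hi.1),
    v', w', n, rfl, rfl, hn, hv'.mono fun _ hi => hi.2⟩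

theorem exists_of_frown (hc : Connective.frown ∈ Λ) (h : SimulatesAlong Λ s x y)
    {y' : (ultraproduct 𝒰 N).World} (hy' : (ultraproduct 𝒰 N).R y y') :
    ∃ x', (ultraproduct 𝒰 M).R x x' ∧ SimulatesAlong Λ s y' x' := by
  obtain ⟨w, v, n, rfl, rfl, hn, hsim⟩ := h.exists_succ
  obtain ⟨v', rfl⟩ := ultraproduct.exists_mk_eq y'
  have hstep : ∀ᶠ i in 𝒰, ∃ w', (M i).R (w i) w' ∧
      SimulatesUpTo Λ (s i) (n i) (N i) (M i) (v' i) w' := by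
    filter_upwards [hsim, ultraproduct.R_mk_mk.1 hy'] with i hi hv'
    obtain ⟨-, -, hfrown⟩ := hi
    exact hfrown hc _ hv'
  obtain ⟨w', hw'⟩ := skolem.1 hstep
  exact ⟨ultraproduct.mk 𝒰 w', ultraproduct.R_mk_mk.2 (hw'.mono fun _ hi => hi.1),
    v', w', n, rfl, rfl, hn, hw'.mono fun _ hi => hi.2⟩

theorem isDirectedSimulation (hs : ∀ k, ∀ᶠ i in 𝒰, k ∈ s i) :
    IsDirectedSimulation Λ (ultraproduct 𝒰 M) (ultraproduct 𝒰 N)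
      (SimulatesAlong Λ s) (SimulatesAlong Λ s) where
  forth_letter _ _ _ h := h.mem_P hs
  back_letter _ _ _ h := h.mem_P hs
  forth_smile hc _ _ _ h := h.exists_of_smile hc
  back_smile hc _ _ _ h := h.exists_of_smile hc
  forth_frown hc _ _ _ h := h.exists_of_frown hc
  back_frown hc _ _ _ h := h.exists_of_frown hc

end SimulatesAlong

theorem PreservedByDirectedSimulations.exists_of_simulatesUpTo {α : FOFormula K}
    (hα : PreservedByDirectedSimulations Λ α) :
    ∃ (s : Finset K) (n : ℕ), ∀ (M₁ M₂ : KripkeModel K) (w₁ : M₁.World) (w₂ : M₂.World),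
      SimulatesUpTo Λ s n M₁ M₂ w₁ w₂ → M₁.SatisfiesAt α w₁ → M₂.SatisfiesAt α w₂ := by
  classical
  by_contra! hcounter
  choose M N w v hsim hw hv using fun i : Finset K × ℕ => hcounter i.1 i.2
  let 𝒰 : Ultrafilter (Finset K × ℕ) := .of atTop
  have hletters (k : K) : ∀ᶠ i in (𝒰 : Filter (Finset K × ℕ)), k ∈ i.1 := by
    filter_upwards [Ultrafilter.of_le atTop (eventually_ge_atTop ({k}, 0))] with i hi
    exact Finset.singleton_subset_iff.1 hi.1
  have hrounds : Tendsto Prod.snd (𝒰 : Filter (Finset K × ℕ)) atTop := by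
    refine Tendsto.mono_left ?_ (Ultrafilter.of_le atTop)
    rw [← prod_atTop_atTop_eq]
    exact tendsto_snd
  have hvα : (ultraproduct 𝒰 N).SatisfiesAt α (ultraproduct.mk 𝒰 v) :=
    hα _ _ _ _ (SimulatesAlong.isDirectedSimulation hletters) _ _
      ⟨w, v, Prod.snd, rfl, rfl, hrounds, .of_forall hsim⟩
      (ultraproduct.satisfiesAt_mk.2 (.of_forall hw))
  obtain ⟨i, hi⟩ := (ultraproduct.satisfiesAt_mk.1 hvα).exists
  exact hv i hi

end Ultraproduct

end RestorativeModal

theorem corollary6p5 {K : Type u} (Λ : RestorativeModal.SimilarityType)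
    (hΛ : Λ ⊆ {RestorativeModal.Connective.smile, RestorativeModal.Connective.frown})
    (α : RestorativeModal.FOFormula K) :
    (∃ φ : RestorativeModal.ModalFormula K Λ,
        RestorativeModal.Equivalent α (RestorativeModal.standardTranslation φ)) ↔
      RestorativeModal.PreservedByDirectedSimulations Λ α := by
  simp only [RestorativeModal.equivalent_standardTranslation_iff]
  constructor
  · rintro ⟨φ, hφ⟩ M₁ M₂ F B hFB w₁ w₂ hF hw₁
    exact (hφ M₂ w₂).2 (hFB.sat_of_sat hΛ hF ((hφ M₁ w₁).1 hw₁))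
  · intro hα
    obtain ⟨s, n, hsim⟩ := hα.exists_of_simulatesUpTo
    obtain ⟨l, hl⟩ := RestorativeModal.exists_list_simulatesUpTo Λ s n
    exact RestorativeModal.exists_sat_iff_of_transfersTruth l
      fun M₁ M₂ w₁ w₂ hw => hsim M₁ M₂ w₁ w₂ (hl M₁ M₂ w₁ w₂ hw)
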